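/- Let $K\ge 1$, $E>0$ and $V>0$. There is a constant $C>0$, depending only on $K$, $E$ and $V$, with the following property. Let $\Omega\subset\mathbb R^n$, $n\ge 1$, be a bounded domain (a nonempty, connected, open set) with Lebesgue measure $|\Omega|=V$, and suppose that $\Omega$ is of Lipschitz class with constants $\rho,M>0$. This means that for every $P\in\partial\Omega$ there is a rigid transformation of coordinates under which $P=0$ and, writing $x=(x',x_n)$ and $\Gamma=\{x : |x'|<\rho/M,\ |x_n|<\rho\}$, $$\Omega\cap\Gamma=\{x\in\Gamma : x_n>Z(x')\},$$ where $Z$ is a Lipschitz function on $B'=\{x'\in\mathbb R^{n-1} : |x'|<\rho/M\}$ with $Z(0)=0$ and $\|Z\|_{L^\infty(B')}+\rho\|\nabla Z\|_{L^\infty(B')}\le M\rho$. Let $q_1,q_2\in L^\infty(\Omega)$ satisfy $K^{-1}\le q_i\le K$ a.e. in $\Omega$, and for $i=1,2$ let $u_i\in W^{1,2}(\Omega)\cap C(\overline\Omega)$ be a (real-valued) weak solution of $\Delta u_i+q_iu_i=0$ in $\Omega$ such that $$\int_\Omega\left(u_i^2+|\nabla u_i|^2\right)\le E^2,\qquad \int_\Omega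 q_iu_i^2\ge H^2$$ for some $H>0$. Let $\varepsilon>0$ and suppose that $$\|q_1u_1^2-q_2u_2^2\|_{L^\infty(\Omega)}\le\varepsilon,\qquad \big\||u_1|-|u_2|\big\|_{L^\infty(\partial\Omega)}\le\sqrt{K\varepsilon},$$ where $L^\infty(\partial\Omega)$ is taken with respect to the $(n-1)$-dimensional Hausdorff measure. Then $$\int_\Omega\left(|u_1|+|u_2|\right)\left(|u_1|-|u_2|\right)^2\le C\varepsilon .$$ -/

import Mathlib

open MeasureTheory Set
open scoped ENNReal ContDiff

namespace HybridInverse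

/-- `x'`, the first `n` coordinates of a point `x = (x', xₙ)` of the space of dimension `n + 1`. -/
noncomputable def horiz {n : ℕ} (x : EuclideanSpace ℝ (Fin (n + 1))) : EuclideanSpace ℝ (Fin n) :=
  WithLp.toLp 2 fun i => x i.castSucc

/-- The last coordinate of a point `x = (x', xₙ)`. -/
def vert {n : ℕ} (x : EuclideanSpace ℝ (Fin (n + 1))) : ℝ := x (Fin.last n)

/-- The cylinder of radius `a` and half-height `b` centred at the origin. -/
def cylinder (n : ℕ) (a b : ℝ) : Set (EuclideanSpace ℝ (Fin (n + 1))) :=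
  {x | ‖horiz x‖ < a ∧ |vert x| < b}

/-- `Ω` is of Lipschitz class with constants `ρ`, `M`: around each boundary point `P`, after a
rigid transformation `T` of coordinates taking `P` to the origin, `Ω` is in the cylinder
of radius `ρ / M` and half-height `ρ` the part above the graph of a Lipschitz function `Z` with
`Z 0 = 0` and `‖Z‖_∞ + ρ ‖∇Z‖_∞ ≤ M ρ`. -/
def IsLipschitzClass {n : ℕ} (Ω : Set (EuclideanSpace ℝ (Fin (n + 1)))) (ρ M : ℝ) : Prop :=
  ∀ P ∈ frontier Ω,
    ∃ (T : EuclideanSpace ℝ (Fin (n + 1)) ≃ᵢ EuclideanSpace ℝ (Fin (n + 1)))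
      (Z : EuclideanSpace ℝ (Fin n) → ℝ),
      T P = 0 ∧
      (∃ L, LipschitzOnWith L Z (Metric.ball 0 (ρ / M))) ∧
      Z 0 = 0 ∧
      eLpNorm Z ∞ (volume.restrict (Metric.ball 0 (ρ / M))) +
          ENNReal.ofReal ρ *
            eLpNorm (fun y => gradient Z y) ∞ (volume.restrict (Metric.ball 0 (ρ / M)))
        ≤ ENNReal.ofReal (M * ρ) ∧
      (T '' Ω) ∩ cylinder n (ρ / M) ρ = {x ∈ cylinder n (ρ / M) ρ | Z (horiz x) < vert x}

/-- Smooth test functions with compact support in `Ω`. -/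
structure IsTestFunction {d : ℕ} (Ω : Set (EuclideanSpace ℝ (Fin d)))
    (φ : EuclideanSpace ℝ (Fin d) → ℝ) : Prop where
  smooth : ContDiff ℝ ∞ φ
  compactSupport : HasCompactSupport φ
  support_subset : tsupport φ ⊆ Ω

/-- `u` belongs to `W^{1,2}(Ω)` and `g` is its weak gradient. -/
structure IsW12WithGradient {d : ℕ} (Ω : Set (EuclideanSpace ℝ (Fin d)))
    (u : EuclideanSpace ℝ (Fin d) → ℝ)
    (g : EuclideanSpace ℝ (Fin d) → EuclideanSpace ℝ (Fin d)) : Prop where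
  memLp : MemLp u 2 (volume.restrict Ω)
  memLp_gradient : MemLp g 2 (volume.restrict Ω)
  weak_gradient : ∀ φ, IsTestFunction Ω φ →
    ∫ x in Ω, u x • gradient φ x = -∫ x in Ω, φ x • g x

/-- `u ∈ W^{1,2}(Ω)`, with weak gradient `g`, is a weak solution of `Δu + q u = 0` in `Ω`. -/
structure IsWeakSolution {d : ℕ} (Ω : Set (EuclideanSpace ℝ (Fin d)))
    (q u : EuclideanSpace ℝ (Fin d) → ℝ)
    (g : EuclideanSpace ℝ (Fin d) → EuclideanSpace ℝ (Fin d)) : Prop where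
  isW12 : IsW12WithGradient Ω u g
  weak_equation : ∀ φ, IsTestFunction Ω φ →
    ∫ x in Ω, inner ℝ (g x) (gradient φ x) = ∫ x in Ω, q x * u x * φ x

/-- The a priori assumptions on one pair `(q, u)`: `q ∈ L^∞(Ω)` with `K⁻¹ ≤ q ≤ K` a.e.,
`u ∈ W^{1,2}(Ω) ∩ C(closure Ω)` is a weak solution of `Δu + q u = 0`, with weak gradient `g`,
`∫ (u² + |∇u|²) ≤ E²` and `∫ q u² ≥ H²`. -/
structure APriori {d : ℕ} (Ω : Set (EuclideanSpace ℝ (Fin d))) (K E H : ℝ)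
    (q u : EuclideanSpace ℝ (Fin d) → ℝ)
    (g : EuclideanSpace ℝ (Fin d) → EuclideanSpace ℝ (Fin d)) : Prop where
  memLp_q : MemLp q ∞ (volume.restrict Ω)
  bounds_q : ∀ᵐ x ∂(volume.restrict Ω), K⁻¹ ≤ q x ∧ q x ≤ K
  continuousOn : ContinuousOn u (closure Ω)
  solution : IsWeakSolution Ω q u g
  energy : ∫ x in Ω, (u x ^ 2 + ‖g x‖ ^ 2) ≤ E ^ 2
  nondegenerate : H ^ 2 ≤ ∫ x in Ω, q x * u x ^ 2

end HybridInverse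

namespace HybridInverse

open Filter Topology Metric Convolution

/-! Fix a choice of signs and let `v₁`, `v₂` be the correspondingly signed solutions, on the open
set `G` where both are positive. Put s = v₁ + v₂, w = v₁ - v₂, P = q₁v₁ - q₂v₂, Q = q₁v₁ + q₂v₂ and
f = q₁v₁² - q₂v₂². Then Δs = -Q, Δw = -P, and algebra gives sP + wQ = 2f, which is at most 2ε in
absolute value.

For nondecreasing F with primitive Φ, the divergence of sF(w)∇w - Φ(w)∇s is sF'(w)|∇w|² + sF(w)Δw -
Φ(w)Δs. If F(w) and Φ(w) have compact support in `G`, integrating and dropping the gradient term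
gives ∫ (sF(w)P - Φ(w)Q) ≥ 0. As Φ and Q are nonnegative, ∫ QwF(w) ≤ 2 ∫ fF(w) ≤ 2ε ∫ s. Since Q ≥
s/K, and F is the identity up to truncation at a height of order √(Kε), this bounds ∫ sw².

The truncation supplies the compact support: |w| ≤ √(Kε) on the boundary of `G`, by hypothesis on
∂Ω, and inside Ω because where one solution vanishes the closeness of the energies makes the other
small. Thus no regularity of the nodal sets is needed. The Lipschitz class serves to turn the
essential bound on ∂Ω into a pointwise one (`abs_le_on_frontier`).

The smooth inequality is `integral_primitive_lap_sub_nonneg`; mollification carries it to weak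
solutions in `setIntegral_truncation_nonneg`; `setIntegral_pos_le` is the estimate on `G`. Four
choices of signs and the nodal sets exhaust Ω. -/

/-- The `i`-th partial derivative. -/
noncomputable def pderiv {d : ℕ} (i : Fin d) (f : EuclideanSpace ℝ (Fin d) → ℝ) :
    EuclideanSpace ℝ (Fin d) → ℝ :=
  fun x => fderiv ℝ f x (EuclideanSpace.single i 1)

/-- The Laplacian, as the sum of the second partial derivatives. -/
noncomputable def lap {d : ℕ} (f : EuclideanSpace ℝ (Fin d) → ℝ) :
    EuclideanSpace ℝ (Fin d) → ℝ :=
  fun x => ∑ i, pderiv i (pderiv i f) x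

/-! ### Calculus of partial derivatives and the Laplacian -/

variable {d : ℕ}

lemma contDiff_pderiv {f : EuclideanSpace ℝ (Fin d) → ℝ} (hf : ContDiff ℝ ∞ f) (i : Fin d) :
    ContDiff ℝ ∞ (pderiv i f) :=
  (hf.fderiv_right (m := ∞) (by simp)).clm_apply contDiff_const

lemma contDiff_lap {f : EuclideanSpace ℝ (Fin d) → ℝ} (hf : ContDiff ℝ ∞ f) :
    ContDiff ℝ ∞ (lap f) :=
  ContDiff.sum fun i _ => contDiff_pderiv (contDiff_pderiv hf i) i

lemma tsupport_pderiv_subset (f : EuclideanSpace ℝ (Fin d) → ℝ) (i : Fin d) :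
    tsupport (pderiv i f) ⊆ tsupport f :=
  tsupport_fderiv_apply_subset ℝ _

lemma hasCompactSupport_pderiv {f : EuclideanSpace ℝ (Fin d) → ℝ} (hf : HasCompactSupport f)
    (i : Fin d) : HasCompactSupport (pderiv i f) :=
  hf.fderiv_apply ℝ _

lemma IsTestFunction.pderiv {Ω : Set (EuclideanSpace ℝ (Fin d))}
    {φ : EuclideanSpace ℝ (Fin d) → ℝ} (hφ : IsTestFunction Ω φ) (i : Fin d) :
    IsTestFunction Ω (pderiv i φ) :=
  ⟨contDiff_pderiv hφ.smooth i, hasCompactSupport_pderiv hφ.compactSupport i,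
    (tsupport_pderiv_subset φ i).trans hφ.support_subset⟩

lemma tsupport_lap_subset (f : EuclideanSpace ℝ (Fin d) → ℝ) : tsupport (lap f) ⊆ tsupport f := by
  refine closure_minimal (fun x hx => ?_) (isClosed_tsupport f)
  by_contra h
  refine hx (Finset.sum_eq_zero fun i _ => image_eq_zero_of_notMem_tsupport fun h' => h ?_)
  exact tsupport_pderiv_subset f i (tsupport_pderiv_subset _ i h')

lemma gradient_apply (f : EuclideanSpace ℝ (Fin d) → ℝ) (x : EuclideanSpace ℝ (Fin d))
    (i : Fin d) : gradient f x i = pderiv i f x := by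
  have h := inner_gradient_left (𝕜 := ℝ) (f := f) (x := x) (y := EuclideanSpace.single i (1 : ℝ))
  rw [EuclideanSpace.inner_single_right] at h
  rw [pderiv, ← h]
  simp

lemma pderiv_mul {f g : EuclideanSpace ℝ (Fin d) → ℝ} (hf : Differentiable ℝ f)
    (hg : Differentiable ℝ g) (i : Fin d) (x : EuclideanSpace ℝ (Fin d)) :
    pderiv i (fun y => f y * g y) x = pderiv i f x * g x + f x * pderiv i g x := by
  simp only [pderiv]
  rw [fderiv_fun_mul (hf x) (hg x)]
  simp
  ring

lemma pderiv_sub {f g : EuclideanSpace ℝ (Fin d) → ℝ} (hf : Differentiable ℝ f)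
    (hg : Differentiable ℝ g) (i : Fin d) (x : EuclideanSpace ℝ (Fin d)) :
    pderiv i (fun y => f y - g y) x = pderiv i f x - pderiv i g x := by
  simp only [pderiv]
  rw [fderiv_fun_sub (hf x) (hg x)]
  simp

lemma pderiv_comp {F : ℝ → ℝ} {F' : ℝ} {f : EuclideanSpace ℝ (Fin d) → ℝ}
    {x : EuclideanSpace ℝ (Fin d)} (hF : HasDerivAt F F' (f x)) (hf : Differentiable ℝ f)
    (i : Fin d) : pderiv i (fun y => F (f y)) x = F' * pderiv i f x := by
  have h : HasFDerivAt (fun y => F (f y)) (F' • fderiv ℝ f x) x :=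
    hF.comp_hasFDerivAt x (hf x).hasFDerivAt
  simp [pderiv, h.fderiv]

lemma pderiv_comp_const_sub {f : EuclideanSpace ℝ (Fin d) → ℝ} (hf : Differentiable ℝ f)
    (i : Fin d) (c x : EuclideanSpace ℝ (Fin d)) :
    pderiv i (fun y => f (c - y)) x = -pderiv i f (c - x) := by
  have h : HasFDerivAt (fun y => f (c - y))
      ((fderiv ℝ f (c - x)).comp (-ContinuousLinearMap.id ℝ _)) x :=
    (hf (c - x)).hasFDerivAt.comp x ((hasFDerivAt_id x).const_sub c)
  simp [pderiv, h.fderiv]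

lemma lap_comp_const_sub {f : EuclideanSpace ℝ (Fin d) → ℝ} (hf : ContDiff ℝ ∞ f)
    (c x : EuclideanSpace ℝ (Fin d)) : lap (fun y => f (c - y)) x = lap f (c - x) := by
  refine Finset.sum_congr rfl fun i _ => ?_
  have h : pderiv i (fun y => f (c - y)) = fun y => -pderiv i f (c - y) :=
    funext fun y => pderiv_comp_const_sub (hf.differentiable (by simp)) i c y
  have h' := pderiv_comp_const_sub
    ((contDiff_pderiv hf i).neg.differentiable (by simp)) i c x
  rw [h]
  refine h'.trans ?_
  have h2 := (((contDiff_pderiv hf i).differentiable (by simp)) (c - x)).hasFDerivAt.fun_neg.fderiv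
  rw [pderiv, h2]
  simp [pderiv]

/-! ### The divergence inequality for smooth functions -/

lemma integral_pderiv_eq_zero {h : EuclideanSpace ℝ (Fin d) → ℝ} (hh : ContDiff ℝ 1 h)
    (hc : HasCompactSupport h) (i : Fin d) : ∫ x, pderiv i h x = 0 := by
  have hi : Integrable (pderiv i h) := by
    refine Continuous.integrable_of_hasCompactSupport ?_ (hasCompactSupport_pderiv hc i)
    exact (hh.continuous_fderiv (by simp)).clm_apply continuous_const
  -- Integration by parts against the constant 1.
  have := integral_mul_fderiv_eq_neg_fderiv_mul_of_integrable (μ := volume)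
    (f := fun _ : EuclideanSpace ℝ (Fin d) => (1 : ℝ)) (g := h)
    (v := EuclideanSpace.single i (1 : ℝ)) (by simp) (by simp only [one_mul]; exact hi)
    (by simpa using hh.continuous.integrable_of_hasCompactSupport hc)
    (fun _ _ => by fun_prop) (fun x _ => (hh.differentiable (by simp)) x)
  simpa [pderiv] using this

/-- Testing `Δ w` with `s F(w)` and `Δ s` with a primitive of `F` evaluated at `w`: for
nondecreasing `F` and nonnegative `s`, the cross terms cancel and what remains has a sign. -/
lemma integral_primitive_lap_sub_nonneg {s w : EuclideanSpace ℝ (Fin d) → ℝ}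
    {F Φ : ℝ → ℝ} {A : Set (EuclideanSpace ℝ (Fin d))} (hs : ContDiff ℝ ∞ s)
    (hw : ContDiff ℝ ∞ w) (hs0 : ∀ x, 0 ≤ s x) (hF : ContDiff ℝ ∞ F) (hΦ : ContDiff ℝ ∞ Φ)
    (hΦF : ∀ y, HasDerivAt Φ (F y) y) (hmono : Monotone F) (hA : IsCompact A)
    (hFA : ∀ x ∉ A, F (w x) = 0) (hΦA : ∀ x ∉ A, Φ (w x) = 0) :
    0 ≤ ∫ x, (Φ (w x) * lap s x - s x * F (w x) * lap w x) := by
  have hds : Differentiable ℝ s := hs.differentiable (by simp)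
  have hdw : Differentiable ℝ w := hw.differentiable (by simp)
  have hFw : ContDiff ℝ ∞ fun x => F (w x) := hF.comp hw
  have hΦw : ContDiff ℝ ∞ fun x => Φ (w x) := hΦ.comp hw
  -- Components of the flux sF(w)∇w - Φ(w)∇s, which vanishes off `A`.
  set h : Fin d → EuclideanSpace ℝ (Fin d) → ℝ := fun i x =>
    s x * F (w x) * pderiv i w x - Φ (w x) * pderiv i s x with hh
  have hhs : ∀ i, ContDiff ℝ ∞ (h i) := fun i =>
    ((hs.mul hFw).mul (contDiff_pderiv hw i)).sub (hΦw.mul (contDiff_pderiv hs i))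
  have hhc : ∀ i, HasCompactSupport (h i) := fun i =>
    HasCompactSupport.intro hA fun x hx => by simp [hh, hFA x hx, hΦA x hx]
  have hz : ∑ i, ∫ x, pderiv i (h i) x = 0 :=
    Finset.sum_eq_zero fun i _ => integral_pderiv_eq_zero ((hhs i).of_le (by simp)) (hhc i) i
  have hint : ∀ i, Integrable (pderiv i (h i)) := fun i =>
    (contDiff_pderiv (hhs i) i).continuous.integrable_of_hasCompactSupport
      (hasCompactSupport_pderiv (hhc i) i)
  rw [← integral_finsetSum _ fun i _ => hint i] at hz
  -- Both products contribute F(w)∇s·∇w, with opposite signs, because Φ' = F.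
  have hid : ∀ x, ∑ i, pderiv i (h i) x =
      (∑ i, s x * (deriv F (w x) * pderiv i w x ^ 2)) +
        (s x * F (w x) * lap w x - Φ (w x) * lap s x) := by
    intro x
    simp only [lap, Finset.mul_sum]
    rw [← Finset.sum_sub_distrib, ← Finset.sum_add_distrib]
    refine Finset.sum_congr rfl fun i _ => ?_
    have hsF : Differentiable ℝ fun x => s x * F (w x) := (hs.mul hFw).differentiable (by simp)
    have hdF : HasDerivAt F (deriv F (w x)) (w x) :=
      (hF.differentiable (by simp) (w x)).hasDerivAt
    have hpw : Differentiable ℝ (pderiv i w) := (contDiff_pderiv hw i).differentiable (by simp)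
    have hps : Differentiable ℝ (pderiv i s) := (contDiff_pderiv hs i).differentiable (by simp)
    have hdΦ : Differentiable ℝ fun x => Φ (w x) := hΦw.differentiable (by simp)
    rw [hh]
    simp only
    rw [pderiv_sub (hsF.fun_mul hpw) (hdΦ.fun_mul hps),
      pderiv_mul hsF hpw, pderiv_mul hdΦ hps, pderiv_mul hds (hFw.differentiable (by simp)),
      pderiv_comp hdF hdw, pderiv_comp (hΦF _) hdw]
    ring
  have hle : ∫ x, -(Φ (w x) * lap s x - s x * F (w x) * lap w x) ≤ 0 := by
    rw [← hz]
    refine integral_mono ?_ (integrable_finsetSum _ fun i _ => hint i) fun x => ?_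
    · refine Continuous.integrable_of_hasCompactSupport ?_
        (HasCompactSupport.intro hA fun x hx => by simp [hFA x hx, hΦA x hx])
      exact ((hΦw.continuous.mul (contDiff_lap hs).continuous).sub
        ((hs.mul hFw).continuous.mul (contDiff_lap hw).continuous)).neg
    · simp only [hid x]
      have : 0 ≤ ∑ i, s x * (deriv F (w x) * pderiv i w x ^ 2) :=
        Finset.sum_nonneg fun i _ => mul_nonneg (hs0 x)
          (mul_nonneg hmono.deriv_nonneg (sq_nonneg _))
      linarith
  rw [integral_neg] at hle
  linarith

/-! ### Mollification of a distributional equation -/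

lemma pderiv_convolution {k f : EuclideanSpace ℝ (Fin d) → ℝ} (hk : ContDiff ℝ ∞ k)
    (hkc : HasCompactSupport k) (hf : LocallyIntegrable f) (i : Fin d) :
    pderiv i (k ⋆[ContinuousLinearMap.lsmul ℝ ℝ, volume] f) =
      (pderiv i k) ⋆[ContinuousLinearMap.lsmul ℝ ℝ, volume] f := by
  ext x
  have h := hkc.hasFDerivAt_convolution_left (ContinuousLinearMap.lsmul ℝ ℝ)
    (hk.of_le (by simp)) hf x
  rw [pderiv, h.fderiv]
  have := (hkc.fderiv ℝ).convolutionExists_left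
    ((ContinuousLinearMap.lsmul ℝ ℝ).precompL (EuclideanSpace ℝ (Fin d)))
    (hk.continuous_fderiv (by simp)) hf x
  simp_rw [convolution_def, ContinuousLinearMap.integral_apply this]
  rfl

/-- All derivatives fall on the kernel, so that y ↦ k(x - y) can serve as the test function in the
weak equation. -/
lemma lap_convolution {k f : EuclideanSpace ℝ (Fin d) → ℝ} (hk : ContDiff ℝ ∞ k)
    (hkc : HasCompactSupport k) (hf : LocallyIntegrable f) (x : EuclideanSpace ℝ (Fin d)) :
    lap (k ⋆[ContinuousLinearMap.lsmul ℝ ℝ, volume] f) x = ∫ y, lap k (x - y) * f y := by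
  simp only [lap, Finset.sum_mul]
  rw [integral_finsetSum]
  · refine Finset.sum_congr rfl fun i _ => ?_
    rw [pderiv_convolution hk hkc hf, pderiv_convolution (contDiff_pderiv hk i)
      (hasCompactSupport_pderiv hkc i) hf, convolution_lsmul_swap]
    simp
  · intro i _
    have hc := contDiff_pderiv (contDiff_pderiv hk i) i
    have hcc := hasCompactSupport_pderiv (hasCompactSupport_pderiv hkc i) i
    have h := hcc.convolutionExists_left (ContinuousLinearMap.lsmul ℝ ℝ)
      hc.continuous hf x
    simpa using h.integrable_swap

/-- If `Δ f = -p` weakly in `G` and `χ = 1` near `x`, a mollification of `χ f` satisfies the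
mollified equation at `x`. -/
lemma lap_convolution_cutoff {G : Set (EuclideanSpace ℝ (Fin d))}
    {f p χ k : EuclideanSpace ℝ (Fin d) → ℝ} {x : EuclideanSpace ℝ (Fin d)} {R : ℝ}
    (hfp : ∀ φ, IsTestFunction G φ → ∫ y, f y * lap φ y = -∫ y, p y * φ y)
    (hk : ContDiff ℝ ∞ k) (hkR : tsupport k ⊆ closedBall 0 R)
    (hxG : closedBall x R ⊆ G) (hχ : ∀ y ∈ closedBall x R, χ y = 1)
    (hf : LocallyIntegrable fun y => χ y * f y) :
    lap (k ⋆[ContinuousLinearMap.lsmul ℝ ℝ, volume] fun y => χ y * f y) x =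
      -(k ⋆[ContinuousLinearMap.lsmul ℝ ℝ, volume] fun y => χ y * p y) x := by
  have hkc : HasCompactSupport k :=
    HasCompactSupport.of_support_subset_isCompact (isCompact_closedBall 0 R)
      ((subset_tsupport k).trans hkR)
  have hsupp : tsupport (fun y => k (x - y)) ⊆ closedBall x R := by
    refine closure_minimal (fun y hy => ?_) isClosed_closedBall
    have := hkR (subset_tsupport k hy)
    simpa [dist_eq_norm, norm_sub_rev] using this
  have hφ : IsTestFunction G fun y => k (x - y) :=
    ⟨hk.comp (contDiff_const.sub contDiff_id),
      HasCompactSupport.of_support_subset_isCompact (isCompact_closedBall x R)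
        ((subset_tsupport _).trans hsupp), hsupp.trans hxG⟩
  rw [lap_convolution hk hkc hf, convolution_lsmul_swap]
  have h1 : ∀ y, lap k (x - y) * (χ y * f y) = f y * lap (fun y => k (x - y)) y := by
    intro y
    rw [lap_comp_const_sub hk]
    by_cases hy : y ∈ closedBall x R
    · rw [hχ y hy]; ring
    · have : lap k (x - y) = 0 := by
        rw [← lap_comp_const_sub hk]
        exact image_eq_zero_of_notMem_tsupport fun h => hy (hsupp (tsupport_lap_subset _ h))
      simp [this]
  have h2 : ∀ y, k (x - y) • (χ y * p y) = p y * k (x - y) := by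
    intro y
    by_cases hy : y ∈ closedBall x R
    · rw [hχ y hy, smul_eq_mul]; ring
    · have : k (x - y) = 0 := image_eq_zero_of_notMem_tsupport (f := fun y => k (x - y))
        fun h => hy (hsupp h)
      simp [this]
  simp only [h1, h2]
  exact hfp _ hφ

/-! ### The truncation -/

/-- A smooth odd nondecreasing truncation of the identity at height `t`, with a primitive. -/
lemma exists_truncation {t : ℝ} (ht : 0 < t) :
    ∃ F Φ : ℝ → ℝ, ContDiff ℝ ∞ F ∧ ContDiff ℝ ∞ Φ ∧ (∀ y, HasDerivAt Φ (F y) y) ∧ Monotone F ∧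
      (∀ y, |y| ≤ t → F y = 0) ∧ (∀ y, |y| ≤ t → Φ y = 0) ∧ (∀ y, 0 ≤ Φ y) ∧
      (∀ y, |F y| ≤ |y|) ∧ ∀ y, y ^ 2 ≤ y * F y + 2 * t ^ 2 := by
  -- The argument is nonpositive for |y| ≤ t and at least 1 for y² ≥ 2t². In between, y² itself is
  -- at most 2t², the loss allowed in the last property.
  set F : ℝ → ℝ := fun y => y * Real.smoothTransition ((y ^ 2 - t ^ 2) / t ^ 2) with hFdef
  have hF : ContDiff ℝ ∞ F := by
    refine contDiff_id.mul (Real.smoothTransition.contDiff.comp ?_)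
    exact ((contDiff_id.pow 2).sub contDiff_const).div_const _
  have hder : ∀ y, HasDerivAt (fun x => ∫ z in (0 : ℝ)..x, F z) (F y) y := fun y =>
    intervalIntegral.integral_hasDerivAt_right (hF.continuous.intervalIntegrable _ _)
      (hF.continuous.stronglyMeasurableAtFilter _ _) hF.continuous.continuousAt
  have hzero : ∀ y, |y| ≤ t → F y = 0 := by
    intro y hy
    have : (y ^ 2 - t ^ 2) / t ^ 2 ≤ 0 :=
      div_nonpos_of_nonpos_of_nonneg (by nlinarith [sq_abs y, abs_nonneg y]) (by positivity)
    simp [hFdef, Real.smoothTransition.zero_of_nonpos this]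
  have hmono : Monotone F := by
    refine monotone_of_odd_of_monotoneOn_nonneg (fun y => by simp [hFdef]) ?_
    intro x hx y hy hxy
    have hx' : 0 ≤ x := hx
    refine mul_le_mul hxy (Real.smoothTransition.monotone ?_) (Real.smoothTransition.nonneg _) hy
    gcongr
  have hFzero : F 0 = 0 := by simp [hFdef]
  refine ⟨F, fun x => ∫ z in (0 : ℝ)..x, F z, hF, ?_, hder, hmono, hzero, ?_, ?_, ?_, ?_⟩
  · refine contDiff_infty_iff_deriv.2 ⟨fun y => (hder y).differentiableAt, ?_⟩
    rwa [show deriv (fun x => ∫ z in (0 : ℝ)..x, F z) = F from funext fun y => (hder y).deriv]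
  · intro y hy
    refine intervalIntegral.integral_zero_ae (Eventually.of_forall fun z hz => hzero z ?_)
    have := abs_sub_left_of_mem_uIcc (uIoc_subset_uIcc hz)
    simp only [sub_zero] at this
    exact this.trans hy
  · intro y
    rcases le_total 0 y with hy | hy
    · exact intervalIntegral.integral_nonneg hy fun z hz => hFzero ▸ hmono hz.1
    · simp only
      rw [intervalIntegral.integral_symm, ← intervalIntegral.integral_neg]
      exact intervalIntegral.integral_nonneg hy fun z hz => by
        have := hmono hz.2
        rw [hFzero] at this
        linarith
  · intro y
    rw [hFdef, abs_mul, abs_of_nonneg (Real.smoothTransition.nonneg _)]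
    exact mul_le_of_le_one_right (abs_nonneg y) (Real.smoothTransition.le_one _)
  · intro y
    have hnn : 0 ≤ y * F y := by
      have := Real.smoothTransition.nonneg ((y ^ 2 - t ^ 2) / t ^ 2)
      simp only [hFdef]
      nlinarith [mul_nonneg (sq_nonneg y) this]
    rcases le_total (y ^ 2) (2 * t ^ 2) with h | h
    · linarith
    · have : 1 ≤ (y ^ 2 - t ^ 2) / t ^ 2 := by
        rw [le_div_iff₀ (by positivity)]
        linarith
      simp only [hFdef, Real.smoothTransition.one_of_one_le this]
      nlinarith [sq_nonneg t]

/-! ### Passage from smooth functions to weak solutions -/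

lemma abs_normed_convolution_le (φ : ContDiffBump (0 : EuclideanSpace ℝ (Fin d)))
    {f : EuclideanSpace ℝ (Fin d) → ℝ} {C : ℝ} (hf : ∀ᵐ y, |f y| ≤ C)
    (x : EuclideanSpace ℝ (Fin d)) :
    |(φ.normed volume ⋆[ContinuousLinearMap.lsmul ℝ ℝ, volume] f) x| ≤ C := by
  rw [convolution_lsmul_swap, ← Real.norm_eq_abs]
  have hi : Integrable fun y => φ.normed volume (x - y) * C :=
    (φ.integrable_normed.comp_sub_left x).mul_const C
  refine (norm_integral_le_of_norm_le hi ?_).trans_eq ?_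
  · filter_upwards [hf] with y hy
    rw [norm_smul, Real.norm_of_nonneg (φ.nonneg_normed _), Real.norm_eq_abs]
    exact mul_le_mul_of_nonneg_left hy (φ.nonneg_normed _)
  · rw [integral_mul_const, integral_sub_left_eq_self (φ.normed volume), φ.integral_normed,
      one_mul]

lemma normed_convolution_nonneg (φ : ContDiffBump (0 : EuclideanSpace ℝ (Fin d)))
    {f : EuclideanSpace ℝ (Fin d) → ℝ} (hf : ∀ y, 0 ≤ f y) (x : EuclideanSpace ℝ (Fin d)) :
    0 ≤ (φ.normed volume ⋆[ContinuousLinearMap.lsmul ℝ ℝ, volume] f) x := by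
  rw [convolution_lsmul_swap]
  exact integral_nonneg fun y => mul_nonneg (φ.nonneg_normed _) (hf y)

/-- Bump functions shrinking to the origin. -/
noncomputable def shrinkingBump (d : ℕ) (m : ℕ) : ContDiffBump (0 : EuclideanSpace ℝ (Fin d)) where
  rIn := 1 / ((m : ℝ) + 1)
  -- A fixed ratio of the radii gives almost everywhere convergence of mollified integrable
  -- functions.
  rOut := 2 * (1 / ((m : ℝ) + 1))
  rIn_pos := Nat.one_div_pos_of_nat
  rIn_lt_rOut := by
    have : 0 < 1 / ((m : ℝ) + 1) := Nat.one_div_pos_of_nat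
    linarith

lemma tendsto_rOut_shrinkingBump :
    Tendsto (fun m => (shrinkingBump d m).rOut) atTop (𝓝 0) := by
  have := (tendsto_one_div_add_atTop_nhds_zero_nat (𝕜 := ℝ)).const_mul 2
  simpa [shrinkingBump] using this

/-- The limit form of `integral_primitive_lap_sub_nonneg`, for continuous weak solutions of
`Δ s = -Q` and `Δ w = -P`. -/
lemma setIntegral_truncation_nonneg {G A : Set (EuclideanSpace ℝ (Fin d))}
    {s w P Q : EuclideanSpace ℝ (Fin d) → ℝ} {K t₀ t : ℝ} {F Φ : ℝ → ℝ}
    (hG : IsOpen G) (hA : IsCompact A) (hAG : A ⊆ G)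
    (hs : ContinuousOn s G) (hw : ContinuousOn w G) (hs0 : ∀ x ∈ G, 0 ≤ s x)
    (hPm : AEStronglyMeasurable P (volume.restrict G))
    (hQm : AEStronglyMeasurable Q (volume.restrict G))
    (hP : ∀ᵐ x ∂volume.restrict G, |P x| ≤ K * s x)
    (hQ : ∀ᵐ x ∂volume.restrict G, |Q x| ≤ K * s x) (hK : 0 ≤ K)
    (hsQ : ∀ φ, IsTestFunction G φ → ∫ y, s y * lap φ y = -∫ y, Q y * φ y)
    (hwP : ∀ φ, IsTestFunction G φ → ∫ y, w y * lap φ y = -∫ y, P y * φ y)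
    (ht₀ : 0 < t₀) (htt : t₀ < t) (hAw : ∀ x ∈ G, t₀ ≤ |w x| → x ∈ A)
    (hF : ContDiff ℝ ∞ F) (hΦ : ContDiff ℝ ∞ Φ) (hΦF : ∀ y, HasDerivAt Φ (F y) y)
    (hmono : Monotone F) (hF0 : ∀ y, |y| ≤ t → F y = 0) (hΦ0 : ∀ y, |y| ≤ t → Φ y = 0) :
    0 ≤ ∫ x in G, (s x * F (w x) * P x - Φ (w x) * Q x) := by
  -- The cutoff equals 1 on a whole δ-neighbourhood of `A`, so mollifying at scale below δ does not
  -- see it at points of `A`.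
  obtain ⟨δ, hδ, hδG⟩ := hA.exists_cthickening_subset_open hG hAG
  obtain ⟨χ, hχ1, hχc, hχG, hχ01⟩ :=
    exists_continuousMap_one_of_isCompact_subset_isOpen hA.cthickening hG hδG
  have hχA : ∀ x ∈ A, χ x = 1 := fun x hx => hχ1 (self_subset_cthickening A hx)
  have hχ0 : ∀ x ∉ G, χ x = 0 := fun x hx =>
    image_eq_zero_of_notMem_tsupport fun h => hx (hχG h)
  have hcut : ∀ f : EuclideanSpace ℝ (Fin d) → ℝ, ContinuousOn f G →
      Continuous (fun x => χ x * f x) ∧ HasCompactSupport fun x => χ x * f x := by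
    intro f hf
    have hc : HasCompactSupport fun x => χ x * f x := HasCompactSupport.mul_right (f := χ) hχc
    refine ⟨ContinuousOn.continuous_of_tsupport_subset (χ.continuous.continuousOn.mul hf) hG ?_, hc⟩
    exact (tsupport_mul_subset_left (f := χ)).trans hχG
  obtain ⟨hsc, hss⟩ := hcut s hs
  obtain ⟨hwc, hws⟩ := hcut w hw
  set S : EuclideanSpace ℝ (Fin d) → ℝ := fun x => χ x * s x with hS
  set W : EuclideanSpace ℝ (Fin d) → ℝ := fun x => χ x * w x with hW
  have hS0 : ∀ x, 0 ≤ S x := fun x => by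
    by_cases hx : x ∈ G
    · exact mul_nonneg (hχ01 x).1 (hs0 x hx)
    · simp [hS, hχ0 x hx]
  have hWA : ∀ x ∉ A, |W x| < t₀ := fun x hx => by
    by_cases hxG : x ∈ G
    · have h1 : |w x| < t₀ := not_le.1 fun h => hx (hAw x hxG h)
      rw [hW, abs_mul, abs_of_nonneg (hχ01 x).1]
      exact (mul_le_of_le_one_left (abs_nonneg _) (hχ01 x).2).trans_lt h1
    · simpa [hW, hχ0 x hxG] using ht₀
  obtain ⟨MS, hMS⟩ := hss.exists_bound_of_continuous hsc
  obtain ⟨MW, hMW⟩ := hws.exists_bound_of_continuous hwc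
  have hcutP : ∀ p : EuclideanSpace ℝ (Fin d) → ℝ,
      AEStronglyMeasurable p (volume.restrict G) →
      (∀ᵐ x ∂volume.restrict G, |p x| ≤ K * s x) →
      Integrable (fun x => χ x * p x) ∧ ∀ᵐ x, |χ x * p x| ≤ K * MS := by
    intro p hpm hp
    have hb : ∀ᵐ x, |χ x * p x| ≤ K * S x := by
      rw [ae_restrict_iff' hG.measurableSet] at hp
      filter_upwards [hp] with x hx
      by_cases hxG : x ∈ G
      · rw [abs_mul, abs_of_nonneg (hχ01 x).1, hS]
        calc χ x * |p x| ≤ χ x * (K * s x) := mul_le_mul_of_nonneg_left (hx hxG) (hχ01 x).1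
          _ = K * (χ x * s x) := by ring
      · simp [hS, hχ0 x hxG]
    refine ⟨?_, ?_⟩
    · rw [← integrableOn_iff_integrable_of_support_subset (s := G)]
      · refine Integrable.mono' ((hsc.integrable_of_hasCompactSupport hss).const_mul K).integrableOn
          (χ.continuous.aestronglyMeasurable.mul hpm) (ae_restrict_of_ae ?_)
        simpa only [Real.norm_eq_abs] using hb
      · intro x hx
        by_contra h
        exact hx (by simp [hχ0 x h])
    · filter_upwards [hb] with x hx
      refine hx.trans (mul_le_mul_of_nonneg_left ?_ hK)
      exact (le_abs_self _).trans (hMS x)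
  obtain ⟨hPi, hPb⟩ := hcutP P hPm hP
  obtain ⟨hQi, hQb⟩ := hcutP Q hQm hQ
  have hSl : LocallyIntegrable S := hsc.locallyIntegrable
  have hWl : LocallyIntegrable W := hwc.locallyIntegrable
  set k : ℕ → EuclideanSpace ℝ (Fin d) → ℝ := fun m => (shrinkingBump d m).normed volume with hk
  have hksm : ∀ m, ContDiff ℝ ∞ (k m) := fun m => (shrinkingBump d m).contDiff_normed
  have hkc : ∀ m, HasCompactSupport (k m) := fun m => (shrinkingBump d m).hasCompactSupport_normed
  set Sm := fun m => k m ⋆[ContinuousLinearMap.lsmul ℝ ℝ, volume] S with hSm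
  set Wm := fun m => k m ⋆[ContinuousLinearMap.lsmul ℝ ℝ, volume] W with hWm
  set Pm := fun m => k m ⋆[ContinuousLinearMap.lsmul ℝ ℝ, volume] fun x => χ x * P x with hPmd
  set Qm := fun m => k m ⋆[ContinuousLinearMap.lsmul ℝ ℝ, volume] fun x => χ x * Q x with hQmd
  have hSms : ∀ m, ContDiff ℝ ∞ (Sm m) := fun m =>
    (hkc m).contDiff_convolution_left _ (hksm m) hSl
  have hWms : ∀ m, ContDiff ℝ ∞ (Wm m) := fun m =>
    (hkc m).contDiff_convolution_left _ (hksm m) hWl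
  have hPms : ∀ m, ContDiff ℝ ∞ (Pm m) := fun m =>
    (hkc m).contDiff_convolution_left _ (hksm m) hPi.locallyIntegrable
  have hQms : ∀ m, ContDiff ℝ ∞ (Qm m) := fun m =>
    (hkc m).contDiff_convolution_left _ (hksm m) hQi.locallyIntegrable
  -- The gap between `t₀` and `t` absorbs the mollification error: off `A` the mollified w stays
  -- below the truncation height.
  have hunif : ∀ᶠ m in atTop, ∀ x, |Wm m x - W x| ≤ t - t₀ := by
    obtain ⟨r, hr, hrW⟩ := Metric.uniformContinuous_iff.1
      (hws.uniformContinuous_of_continuous hwc) (t - t₀) (sub_pos.2 htt)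
    filter_upwards [tendsto_rOut_shrinkingBump.eventually_lt_const hr] with m hm x
    rw [← Real.dist_eq]
    refine (shrinkingBump d m).dist_normed_convolution_le hwc.aestronglyMeasurable fun y hy => ?_
    exact (hrW ((mem_ball.1 hy).trans hm)).le
  have hout : ∀ᶠ m in atTop, ∀ x ∉ A, |Wm m x| ≤ t := by
    filter_upwards [hunif] with m hm x hx
    have h1 := hm x
    have h2 := hWA x hx
    have h3 := abs_sub_abs_le_abs_sub (Wm m x) (W x)
    linarith
  set h : ℕ → EuclideanSpace ℝ (Fin d) → ℝ := fun m x =>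
    Sm m x * F (Wm m x) * Pm m x - Φ (Wm m x) * Qm m x with hh
  have hnonneg : ∀ᶠ m in atTop, 0 ≤ ∫ x, h m x := by
    filter_upwards [hout, tendsto_rOut_shrinkingBump.eventually_lt_const hδ] with m hm hmδ
    have key := integral_primitive_lap_sub_nonneg (hSms m) (hWms m)
      (normed_convolution_nonneg (shrinkingBump d m) hS0) hF hΦ hΦF hmono hA
      (fun x hx => hF0 _ (hm x hx)) (fun x hx => hΦ0 _ (hm x hx))
    refine key.trans_eq (integral_congr_ae (Eventually.of_forall fun x => ?_))
    -- On `A` the mollified equations hold exactly; off `A` the truncated factors vanish and no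
    -- equation is needed.
    by_cases hx : x ∈ A
    · have hball : closedBall x (shrinkingBump d m).rOut ⊆ cthickening δ A :=
        (closedBall_subset_closedBall hmδ.le).trans (closedBall_subset_cthickening hx δ)
      have hkR : tsupport (k m) ⊆ closedBall 0 (shrinkingBump d m).rOut :=
        (shrinkingBump d m).tsupport_normed_eq.subset
      have e1 : lap (Sm m) x = -Qm m x := lap_convolution_cutoff hsQ (hksm m) hkR
        (hball.trans hδG) (fun y hy => hχ1 (hball hy)) hSl
      have e2 : lap (Wm m) x = -Pm m x := lap_convolution_cutoff hwP (hksm m) hkR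
        (hball.trans hδG) (fun y hy => hχ1 (hball hy)) hWl
      simp only [e1, e2, hh]
      ring
    · simp [hh, hF0 _ (hm x hx), hΦ0 _ (hm x hx)]
  obtain ⟨CF, hCF⟩ := isCompact_Icc.exists_bound_of_continuousOn
    (s := Icc (-MW) MW) hF.continuous.continuousOn
  obtain ⟨CΦ, hCΦ⟩ := isCompact_Icc.exists_bound_of_continuousOn
    (s := Icc (-MW) MW) hΦ.continuous.continuousOn
  have hlim : Tendsto (fun m => ∫ x, h m x) atTop
      (𝓝 (∫ x, (S x * F (W x) * (χ x * P x) - Φ (W x) * (χ x * Q x)))) := by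
    refine tendsto_integral_filter_of_dominated_convergence
      (A.indicator fun _ => MS * CF * (K * MS) + CΦ * (K * MS)) ?_ ?_ ?_ ?_
    · refine Eventually.of_forall fun m => Continuous.aestronglyMeasurable ?_
      exact (((hSms m).continuous.mul (hF.continuous.comp (hWms m).continuous)).mul
        (hPms m).continuous).sub ((hΦ.continuous.comp (hWms m).continuous).mul
        (hQms m).continuous)
    · filter_upwards [hout] with m hm
      refine Eventually.of_forall fun x => ?_
      by_cases hx : x ∈ A
      · rw [indicator_of_mem hx]
        have b1 : ‖Sm m x‖ ≤ MS := abs_normed_convolution_le _ (Eventually.of_forall hMS) x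
        have b2 : |Wm m x| ≤ MW := abs_normed_convolution_le _ (Eventually.of_forall hMW) x
        have b3 : ‖Pm m x‖ ≤ K * MS := abs_normed_convolution_le _ hPb x
        have b4 : ‖Qm m x‖ ≤ K * MS := abs_normed_convolution_le _ hQb x
        have b5 := hCF _ (abs_le.1 b2)
        have b6 := hCΦ _ (abs_le.1 b2)
        refine (norm_sub_le _ _).trans (add_le_add ?_ ?_)
        · rw [norm_mul, norm_mul]
          have := (norm_nonneg _).trans b1
          have := (norm_nonneg _).trans b5
          gcongr
        · rw [norm_mul]
          have := (norm_nonneg _).trans b6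
          gcongr
      · simp [hh, hF0 _ (hm x hx), hΦ0 _ (hm x hx), indicator_of_notMem hx]
    · exact (integrable_indicator_iff hA.measurableSet).2
        (integrableOn_const hA.measure_lt_top.ne)
    · have hratio : ∀ᶠ m in atTop,
          (shrinkingBump d m).rOut ≤ 2 * (shrinkingBump d m).rIn :=
        Eventually.of_forall fun m => le_rfl
      -- `P` and `Q` are only measurable, so their mollifications converge almost everywhere; those
      -- of `S` and `W` converge at every point.
      filter_upwards [ContDiffBump.ae_convolution_tendsto_right_of_locallyIntegrable
          tendsto_rOut_shrinkingBump hratio hPi.locallyIntegrable,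
        ContDiffBump.ae_convolution_tendsto_right_of_locallyIntegrable
          tendsto_rOut_shrinkingBump hratio hQi.locallyIntegrable] with x hxP hxQ
      have hxS := ContDiffBump.convolution_tendsto_right_of_continuous (μ := volume)
        (tendsto_rOut_shrinkingBump (d := d)) hsc x
      have hxW := ContDiffBump.convolution_tendsto_right_of_continuous (μ := volume)
        (tendsto_rOut_shrinkingBump (d := d)) hwc x
      exact ((hxS.mul ((hF.continuous.tendsto _).comp hxW)).mul hxP).sub
        (((hΦ.continuous.tendsto _).comp hxW).mul hxQ)
  refine (ge_of_tendsto hlim hnonneg).trans_eq ?_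
  rw [← setIntegral_eq_integral_of_forall_compl_eq_zero (s := G)]
  · refine setIntegral_congr_fun hG.measurableSet fun x hx => ?_
    by_cases hxA : x ∈ A
    · simp [hS, hW, hχA x hxA]
    · have h1 : |w x| ≤ t := (not_le.1 fun h => hxA (hAw x hx h)).le.trans htt.le
      have h2 : |W x| ≤ t := (hWA x hxA).le.trans htt.le
      simp [hF0 _ h1, hF0 _ h2, hΦ0 _ h1, hΦ0 _ h2]
  · intro x hx
    simp [hχ0 x hx]

/-! ### From an essential to a pointwise bound on the boundary -/

lemma ae_abs_le_of_eLpNorm_top_le {α : Type*} [MeasurableSpace α] {μ : Measure α} {f : α → ℝ}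
    {c : ℝ} (hc : 0 ≤ c) (h : eLpNorm f ∞ μ ≤ ENNReal.ofReal c) : ∀ᵐ x ∂μ, |f x| ≤ c := by
  rw [eLpNorm_exponent_top] at h
  filter_upwards [ae_le_eLpNormEssSup (f := f) (μ := μ)] with x hx
  have := hx.trans h
  rwa [← ofReal_norm, ENNReal.ofReal_le_ofReal_iff hc] at this

/-- Being 1-Lipschitz, the projection cannot increase Hausdorff measure, so a boundary piece is at
least as large as its shadow. -/
lemma lipschitzWith_horiz {n : ℕ} : LipschitzWith 1 (horiz (n := n)) := by
  refine LipschitzWith.of_dist_le_mul fun x y => ?_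
  rw [NNReal.coe_one, one_mul, EuclideanSpace.dist_eq, EuclideanSpace.dist_eq]
  refine Real.sqrt_le_sqrt ?_
  rw [Fin.sum_univ_castSucc]
  simp only [horiz]
  exact le_add_of_nonneg_right (sq_nonneg _)

/-- The point of the space of dimension `n + 1` with given horizontal part and height. -/
noncomputable def point {n : ℕ} (y : EuclideanSpace ℝ (Fin n)) (a : ℝ) :
    EuclideanSpace ℝ (Fin (n + 1)) :=
  WithLp.toLp 2 (Fin.snoc (α := fun _ => ℝ) (fun i => y i) a)

lemma horiz_point {n : ℕ} (y : EuclideanSpace ℝ (Fin n)) (a : ℝ) : horiz (point y a) = y := by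
  ext i
  simp [horiz, point]

lemma vert_point {n : ℕ} (y : EuclideanSpace ℝ (Fin n)) (a : ℝ) : vert (point y a) = a := by
  simp [vert, point]

lemma point_zero {n : ℕ} : point (0 : EuclideanSpace ℝ (Fin n)) 0 = 0 := by
  ext i
  refine Fin.lastCases ?_ (fun j => ?_) i <;> simp [point]

lemma continuous_point {n : ℕ} :
    Continuous fun z : EuclideanSpace ℝ (Fin n) × ℝ => point z.1 z.2 := by
  refine (PiLp.continuous_toLp 2 _).comp (continuous_pi fun i => ?_)
  refine Fin.lastCases ?_ (fun j => ?_) i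
  · simpa using continuous_snd
  · simp only [Fin.snoc_castSucc]
    fun_prop

/-- Boundary points of a set of Lipschitz class have neighbourhoods of positive surface measure. -/
lemma hausdorffMeasure_ball_inter_frontier_pos {n : ℕ} {Ω : Set (EuclideanSpace ℝ (Fin (n + 1)))}
    {ρ M r : ℝ} (hΩ : IsOpen Ω) (hρ : 0 < ρ) (hM : 0 < M) (hL : IsLipschitzClass Ω ρ M)
    {p : EuclideanSpace ℝ (Fin (n + 1))} (hp : p ∈ frontier Ω) (hr : 0 < r) :
    0 < Measure.hausdorffMeasure (n : ℝ) (ball p r ∩ frontier Ω) := by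
  obtain ⟨T, Z, hTp, ⟨L, hZL⟩, hZ0, -, hTΩ⟩ := hL p hp
  have hρM : 0 < ρ / M := div_pos hρ hM
  have hZc : ContinuousAt Z 0 :=
    hZL.continuousOn.continuousAt (ball_mem_nhds 0 hρM)
  have hgraph : Tendsto (fun y => point y (Z y)) (𝓝 0) (𝓝 0) := by
    have := (continuous_point (n := n)).tendsto (0, 0)
    rw [point_zero] at this
    have hZt : Tendsto (fun y => (y, Z y)) (𝓝 0) (𝓝 (0, 0)) := by
      rw [nhds_prod_eq]
      exact tendsto_id.prodMk (by simpa [ContinuousAt, hZ0] using hZc)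
    exact this.comp hZt
  have hev : ∀ᶠ y in 𝓝 (0 : EuclideanSpace ℝ (Fin n)),
      y ∈ ball 0 (ρ / M) ∧ |Z y| < ρ ∧ point y (Z y) ∈ ball 0 r := by
    refine Eventually.and (ball_mem_nhds 0 hρM) (Eventually.and ?_
      (hgraph.eventually (ball_mem_nhds 0 hr)))
    have : Tendsto (fun y => |Z y|) (𝓝 0) (𝓝 0) := by
      simpa [ContinuousAt, hZ0] using hZc.abs
    exact this.eventually_lt_const hρ
  obtain ⟨r', hr', hball⟩ := Metric.eventually_nhds_iff_ball.1 hev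
  have hfr : ∀ y ∈ ball (0 : EuclideanSpace ℝ (Fin n)) r', point y (Z y) ∈ frontier (T '' Ω) := by
    intro y hy
    obtain ⟨hy1, hy2, -⟩ := hball y hy
    rw [mem_ball_zero_iff] at hy1
    have hTo : IsOpen (T '' Ω) := T.toHomeomorph.isOpenMap _ hΩ
    refine ⟨?_, ?_⟩
    · have hup : Tendsto (fun a => point y a) (𝓝[>] (Z y)) (𝓝 (point y (Z y))) :=
        ((continuous_point.comp (by fun_prop : Continuous fun a : ℝ => (y, a))).tendsto _).mono_left
          nhdsWithin_le_nhds
      refine mem_closure_of_tendsto hup ?_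
      have h1 : ∀ᶠ a in 𝓝[>] (Z y), |a| < ρ :=
        nhdsWithin_le_nhds ((continuous_abs.tendsto (Z y)).eventually_lt_const hy2)
      filter_upwards [h1, self_mem_nhdsWithin] with a ha ha'
      have hc : point y a ∈ cylinder n (ρ / M) ρ := by
        simpa [cylinder, horiz_point, vert_point] using ⟨hy1, ha⟩
      refine (hTΩ.symm.subset ⟨hc, ?_⟩).1
      simpa [horiz_point, vert_point] using ha'
    · rw [hTo.interior_eq]
      intro hmem
      have hc : point y (Z y) ∈ cylinder n (ρ / M) ρ := by
        simpa [cylinder, horiz_point, vert_point] using ⟨hy1, hy2⟩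
      have := (hTΩ.subset ⟨hmem, hc⟩).2
      simp [horiz_point, vert_point] at this
  -- Every small horizontal y lies under the graph point (y, Z(y)), which belongs to the boundary
  -- and is close to `p`.
  have hsub : ball (0 : EuclideanSpace ℝ (Fin n)) r' ⊆
      (horiz ∘ T) '' (ball p r ∩ frontier Ω) := by
    intro y hy
    have h1 : point y (Z y) ∈ T '' frontier Ω := by
      have : T '' frontier Ω = frontier (T '' Ω) := T.toHomeomorph.image_frontier Ω
      rw [this]
      exact hfr y hy
    obtain ⟨x, hx, hTx⟩ := h1
    refine ⟨x, ⟨?_, hx⟩, ?_⟩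
    · rw [mem_ball, ← T.isometry.dist_eq, hTx, hTp]
      exact (hball y hy).2.2
    · simp [hTx, horiz_point]
  have hlip : LipschitzWith 1 (horiz ∘ T) := by
    simpa using lipschitzWith_horiz.comp T.isometry.lipschitz
  have hle := hlip.hausdorffMeasure_image_le (d := (n : ℝ)) (Nat.cast_nonneg n)
    (ball p r ∩ frontier Ω)
  rw [ENNReal.coe_one, ENNReal.one_rpow, one_mul] at hle
  have hpos : 0 < Measure.hausdorffMeasure (n : ℝ) (ball (0 : EuclideanSpace ℝ (Fin n)) r') := by
    have hHaar := isAddHaarMeasure_hausdorffMeasure (E := EuclideanSpace ℝ (Fin n))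
    rw [finrank_euclideanSpace_fin] at hHaar
    exact measure_ball_pos _ _ hr'
  exact hpos.trans_le ((measure_mono hsub).trans hle)

/-- On the boundary of a set of Lipschitz class an essential bound of a function continuous up to
the boundary is a pointwise bound. -/
lemma abs_le_on_frontier {n : ℕ} {Ω : Set (EuclideanSpace ℝ (Fin (n + 1)))} {ρ M η : ℝ}
    (hΩ : IsOpen Ω) (hρ : 0 < ρ) (hM : 0 < M) (hL : IsLipschitzClass Ω ρ M) (hη : 0 ≤ η)
    {f : EuclideanSpace ℝ (Fin (n + 1)) → ℝ} (hf : ContinuousOn f (closure Ω))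
    (hfη : eLpNorm f ∞ ((Measure.hausdorffMeasure (n : ℝ)).restrict (frontier Ω)) ≤
      ENNReal.ofReal η) :
    ∀ x ∈ frontier Ω, |f x| ≤ η := by
  intro p hp
  by_contra! hlt
  have hae := ae_abs_le_of_eLpNorm_top_le hη hfη
  rw [ae_restrict_iff' isClosed_frontier.measurableSet] at hae
  have hc : ContinuousWithinAt (fun x => |f x|) (frontier Ω) p :=
    ((hf.mono frontier_subset_closure) p hp).abs
  obtain ⟨r, hr, hsub⟩ := Metric.mem_nhdsWithin_iff.1 (hc.eventually_const_lt hlt)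
  refine (hausdorffMeasure_ball_inter_frontier_pos hΩ hρ hM hL hp hr).ne' ?_
  refine measure_mono_null (fun x hx => ?_) (ae_iff.1 hae)
  simpa [hx.2] using hsub hx

/-! ### Weak solutions and their nodal sets -/

/-- The distributional form of the equation `Δ u + q u = 0`. -/
lemma IsWeakSolution.setIntegral_mul_lap {Ω : Set (EuclideanSpace ℝ (Fin d))}
    {q u : EuclideanSpace ℝ (Fin d) → ℝ}
    {g : EuclideanSpace ℝ (Fin d) → EuclideanSpace ℝ (Fin d)} (h : IsWeakSolution Ω q u g)
    {φ : EuclideanSpace ℝ (Fin d) → ℝ} (hφ : IsTestFunction Ω φ) :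
    ∫ x in Ω, u x * lap φ x = -∫ x in Ω, q x * u x * φ x := by
  have hgc : ∀ {ψ : EuclideanSpace ℝ (Fin d) → ℝ}, IsTestFunction Ω ψ →
      MemLp (fun x => gradient ψ x) 2 (volume.restrict Ω) := fun {ψ} hψ => by
    refine (Continuous.memLp_of_hasCompactSupport ?_ ?_).restrict Ω
    · exact (LinearIsometryEquiv.continuous _).comp (hψ.smooth.continuous_fderiv (by simp))
    · exact (hψ.compactSupport.fderiv ℝ).comp_left (map_zero _)
  have hpc : ∀ {ψ : EuclideanSpace ℝ (Fin d) → ℝ}, IsTestFunction Ω ψ →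
      MemLp ψ 2 (volume.restrict Ω) := fun {ψ} hψ =>
    (hψ.smooth.continuous.memLp_of_hasCompactSupport hψ.compactSupport).restrict Ω
  have hi1 : ∀ i, Integrable (fun x => u x • gradient (pderiv i φ) x) (volume.restrict Ω) :=
    fun i => memLp_one_iff_integrable.1 ((hgc (hφ.pderiv i)).smul h.isW12.memLp)
  have hi2 : ∀ i, Integrable (fun x => pderiv i φ x • g x) (volume.restrict Ω) :=
    fun i => memLp_one_iff_integrable.1 (h.isW12.memLp_gradient.smul (hpc (hφ.pderiv i)))
  have hj1 : ∀ i, Integrable (fun x => u x * pderiv i (pderiv i φ) x) (volume.restrict Ω) :=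
    fun i => h.isW12.memLp.integrable_mul (hpc ((hφ.pderiv i).pderiv i))
  have hj2 : ∀ i, Integrable (fun x => pderiv i φ x * g x i) (volume.restrict Ω) := fun i => by
    simpa using (EuclideanSpace.proj (𝕜 := ℝ) i).integrable_comp (hi2 i)
  -- The definition of the weak gradient is tested with ∂ᵢφ and read in the i-th coordinate.
  have hcoord : ∀ i, ∫ x in Ω, u x * pderiv i (pderiv i φ) x =
      -∫ x in Ω, pderiv i φ x * g x i := by
    intro i
    have key := congrArg (EuclideanSpace.proj (𝕜 := ℝ) i)
      (h.isW12.weak_gradient _ (hφ.pderiv i))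
    rw [map_neg, ← ContinuousLinearMap.integral_comp_comm _ (hi1 i),
      ← ContinuousLinearMap.integral_comp_comm _ (hi2 i)] at key
    simpa [gradient_apply] using key
  rw [← h.weak_equation φ hφ]
  simp only [lap, Finset.mul_sum]
  rw [integral_finsetSum _ fun i _ => hj1 i, Finset.sum_congr rfl fun i _ => hcoord i,
    Finset.sum_neg_distrib, ← integral_finsetSum _ fun i _ => hj2 i]
  congr 2
  ext x
  rw [PiLp.inner_apply]
  simp [gradient_apply]

/-- An almost everywhere inequality between functions continuous on an open set holds
everywhere. -/
lemma le_of_ae_le_of_continuousOn {Ω : Set (EuclideanSpace ℝ (Fin d))} (hΩ : IsOpen Ω)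
    {a b : EuclideanSpace ℝ (Fin d) → ℝ} (ha : ContinuousOn a Ω) (hb : ContinuousOn b Ω)
    (hab : ∀ᵐ x ∂volume.restrict Ω, a x ≤ b x) : ∀ x ∈ Ω, a x ≤ b x := by
  intro x hx
  by_contra! hlt
  have hopen : IsOpen (Ω ∩ (fun y => a y - b y) ⁻¹' Ioi 0) :=
    (ha.sub hb).isOpen_inter_preimage hΩ isOpen_Ioi
  rw [ae_restrict_iff' hΩ.measurableSet] at hab
  have hnull : volume (Ω ∩ (fun y => a y - b y) ⁻¹' Ioi 0) = 0 := by
    refine measure_mono_null (fun y hy => ?_) (ae_iff.1 hab)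
    have : 0 < a y - b y := hy.2
    simp only [mem_ofPred_eq, Classical.not_imp, not_le]
    exact ⟨hy.1, by linarith⟩
  have : x ∈ Ω ∩ (fun y => a y - b y) ⁻¹' Ioi 0 := ⟨hx, by simpa using hlt⟩
  rw [(hopen.measure_eq_zero_iff volume).1 hnull] at this
  exact this

/-- Where one of two functions with nearly equal energy densities `q u²` vanishes, the other is
small. -/
lemma abs_le_sqrt_of_eq_zero {Ω : Set (EuclideanSpace ℝ (Fin d))} (hΩ : IsOpen Ω)
    {K ε : ℝ} (hK : 1 ≤ K) {q₁ q₂ u₁ u₂ : EuclideanSpace ℝ (Fin d) → ℝ}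
    (hq₁ : ∀ᵐ x ∂volume.restrict Ω, K⁻¹ ≤ q₁ x ∧ q₁ x ≤ K)
    (hq₂ : ∀ᵐ x ∂volume.restrict Ω, K⁻¹ ≤ q₂ x ∧ q₂ x ≤ K)
    (hu₁ : ContinuousOn u₁ Ω) (hu₂ : ContinuousOn u₂ Ω)
    (hf : ∀ᵐ x ∂volume.restrict Ω, |q₁ x * u₁ x ^ 2 - q₂ x * u₂ x ^ 2| ≤ ε) :
    ∀ x ∈ Ω, u₁ x = 0 → |u₂ x| ≤ √(K * ε) := by
  have hK0 : 0 < K := by linarith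
  -- Eliminating the coefficients leaves an inequality between continuous functions, which can be
  -- evaluated on the nodal set even if that is null.
  have hle : ∀ x ∈ Ω, u₂ x ^ 2 ≤ K * (K * u₁ x ^ 2 + ε) := by
    refine le_of_ae_le_of_continuousOn hΩ (hu₂.pow 2)
      (continuousOn_const.mul ((continuousOn_const.mul (hu₁.pow 2)).add continuousOn_const)) ?_
    filter_upwards [hq₁, hq₂, hf] with x h1 h2 h3
    have h4 := (abs_le.1 h3).1
    have h5 : K⁻¹ * u₂ x ^ 2 ≤ q₂ x * u₂ x ^ 2 := by gcongr; exact h2.1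
    have h6 : q₁ x * u₁ x ^ 2 ≤ K * u₁ x ^ 2 := by gcongr; exact h1.2
    have h7 : K⁻¹ * u₂ x ^ 2 ≤ K * u₁ x ^ 2 + ε := by linarith
    rwa [inv_mul_le_iff₀ hK0] at h7
  intro x hx h0
  have := hle x hx
  rw [h0] at this
  exact Real.abs_le_sqrt (by linarith)

/-- The coefficient is bounded and the other factor is continuous on a compact set. -/
lemma integrableOn_bdd_mul {Ω : Set (EuclideanSpace ℝ (Fin d))} (hb : Bornology.IsBounded Ω)
    {K : ℝ} {q c : EuclideanSpace ℝ (Fin d) → ℝ}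
    (hqm : AEStronglyMeasurable q (volume.restrict Ω))
    (hq : ∀ᵐ x ∂volume.restrict Ω, |q x| ≤ K) (hc : ContinuousOn c (closure Ω)) :
    IntegrableOn (fun x => q x * c x) Ω :=
  ((hc.integrableOn_compact hb.isCompact_closure).mono_set subset_closure).bdd_mul hqm hq

/-! ### The estimate on a region of constant signs -/

/-- The estimate on the set where both solutions are positive. -/
lemma setIntegral_pos_le {Ω : Set (EuclideanSpace ℝ (Fin d))} (hΩ : IsOpen Ω)
    (hb : Bornology.IsBounded Ω) {K ε B : ℝ} (hK : 1 ≤ K) (hε : 0 < ε)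
    {q₁ q₂ v₁ v₂ : EuclideanSpace ℝ (Fin d) → ℝ}
    (hqm₁ : AEStronglyMeasurable q₁ (volume.restrict Ω))
    (hqm₂ : AEStronglyMeasurable q₂ (volume.restrict Ω))
    (hq₁ : ∀ᵐ x ∂volume.restrict Ω, K⁻¹ ≤ q₁ x ∧ q₁ x ≤ K)
    (hq₂ : ∀ᵐ x ∂volume.restrict Ω, K⁻¹ ≤ q₂ x ∧ q₂ x ≤ K)
    (hc₁ : ContinuousOn v₁ (closure Ω)) (hc₂ : ContinuousOn v₂ (closure Ω))
    (hw₁ : ∀ φ, IsTestFunction Ω φ →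
      ∫ x in Ω, v₁ x * lap φ x = -∫ x in Ω, q₁ x * v₁ x * φ x)
    (hw₂ : ∀ φ, IsTestFunction Ω φ →
      ∫ x in Ω, v₂ x * lap φ x = -∫ x in Ω, q₂ x * v₂ x * φ x)
    (hf : ∀ᵐ x ∂volume.restrict Ω, |q₁ x * v₁ x ^ 2 - q₂ x * v₂ x ^ 2| ≤ ε)
    (hfr : ∀ x ∈ frontier Ω, |(|v₁ x| - |v₂ x|)| ≤ √(K * ε))
    (hB : ∫ x in Ω, (|v₁ x| + |v₂ x|) ≤ B) :
    ∫ x in Ω ∩ {x | 0 < v₁ x ∧ 0 < v₂ x}, (|v₁ x| + |v₂ x|) * (|v₁ x| - |v₂ x|) ^ 2 ≤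
      (2 * K + 18 * K ^ 3) * ε * B := by
  have hK0 : 0 < K := by linarith
  set η := √(K * ε) with hη
  have hη0 : 0 < η := Real.sqrt_pos.2 (by positivity)
  have hη2 : η ^ 2 = K * ε := Real.sq_sqrt (by positivity)
  have hco₁ := hc₁.mono (subset_closure (s := Ω))
  have hco₂ := hc₂.mono (subset_closure (s := Ω))
  have hz₁ := abs_le_sqrt_of_eq_zero hΩ hK hq₁ hq₂ hco₁ hco₂ hf
  have hz₂ := abs_le_sqrt_of_eq_zero hΩ hK hq₂ hq₁ hco₂ hco₁
    (by simpa only [abs_sub_comm] using hf)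
  set G := Ω ∩ {x | 0 < v₁ x ∧ 0 < v₂ x} with hGdef
  have hG : IsOpen G := by
    have := (hco₁.prodMk hco₂).isOpen_inter_preimage hΩ 
      ((isOpen_Ioi (a := (0 : ℝ))).prod (isOpen_Ioi (a := (0 : ℝ))))
    exact this
  have hGΩ : G ⊆ Ω := inter_subset_left
  have hKa : ∀ {q : EuclideanSpace ℝ (Fin d) → ℝ},
      (∀ᵐ x ∂volume.restrict Ω, K⁻¹ ≤ q x ∧ q x ≤ K) → ∀ᵐ x ∂volume.restrict Ω, |q x| ≤ K := by
    intro q hq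
    filter_upwards [hq] with x hx
    exact abs_le.2 ⟨by linarith [hx.1, inv_pos.2 hK0], hx.2⟩
  -- Weak inequalities make `A` closed. The threshold 2η exceeds the bound η for |w| on the boundary
  -- of `G`, which keeps `A` inside `G`; the truncation at 3η leaves room for mollification.
  set A := closure Ω ∩ (fun x => (v₁ x, v₂ x)) ⁻¹'
    {z | 0 ≤ z.1 ∧ 0 ≤ z.2 ∧ 2 * η ≤ |z.1 - z.2|}
  have hA : IsCompact A := by
    refine hb.isCompact_closure.of_isClosed_subset
      ((hc₁.prodMk hc₂).preimage_isClosed_of_isClosed isClosed_closure ?_) inter_subset_left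
    exact (isClosed_le continuous_const continuous_fst).inter
      ((isClosed_le continuous_const continuous_snd).inter
        (isClosed_le continuous_const (continuous_fst.sub continuous_snd).abs))
  have hAG : A ⊆ G := by
    rintro x ⟨hx, h1, h2, h3⟩
    simp only at h1 h2 h3
    have hxΩ : x ∈ Ω := by
      by_contra hxn
      have := hfr x ⟨hx, by rwa [hΩ.interior_eq]⟩
      rw [abs_of_nonneg h1, abs_of_nonneg h2] at this
      linarith
    refine ⟨hxΩ, lt_of_le_of_ne h1 fun h => ?_, lt_of_le_of_ne h2 fun h => ?_⟩
    · have := hz₁ x hxΩ h.symm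
      rw [← h, zero_sub, abs_neg] at h3
      linarith
    · have := hz₂ x hxΩ h.symm
      rw [← h, sub_zero] at h3
      linarith
  obtain ⟨F, Φ, hF, hΦ, hΦF, hmono, hF0, hΦ0, hΦnn, hFle, hFsq⟩ :=
    exists_truncation (t := 3 * η) (by positivity)
  have hae : ∀ᵐ x ∂volume.restrict G, (K⁻¹ ≤ q₁ x ∧ q₁ x ≤ K) ∧ (K⁻¹ ≤ q₂ x ∧ q₂ x ≤ K) ∧
      |q₁ x * v₁ x ^ 2 - q₂ x * v₂ x ^ 2| ≤ ε ∧ 0 < v₁ x ∧ 0 < v₂ x := by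
    filter_upwards [ae_restrict_of_ae_restrict_of_subset hGΩ hq₁,
      ae_restrict_of_ae_restrict_of_subset hGΩ hq₂, ae_restrict_of_ae_restrict_of_subset hGΩ hf,
      ae_restrict_mem hG.measurableSet] with x h1 h2 h3 h4
    exact ⟨h1, h2, h3, h4.2⟩
  have hvm₁ := (hco₁.mono hGΩ).aestronglyMeasurable hG.measurableSet (μ := volume)
  have hvm₂ := (hco₂.mono hGΩ).aestronglyMeasurable hG.measurableSet (μ := volume)
  have hqG₁ := hqm₁.mono_set hGΩ
  have hqG₂ := hqm₂.mono_set hGΩ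
  have htest : ∀ {q v : EuclideanSpace ℝ (Fin d) → ℝ},
      (∀ φ, IsTestFunction Ω φ → ∫ x in Ω, v x * lap φ x = -∫ x in Ω, q x * v x * φ x) →
      AEStronglyMeasurable q (volume.restrict Ω) →
      (∀ᵐ x ∂volume.restrict Ω, K⁻¹ ≤ q x ∧ q x ≤ K) → ContinuousOn v (closure Ω) →
      ∀ φ, IsTestFunction G φ → ∫ x, v x * lap φ x = -(∫ x, q x * v x * φ x) ∧
        Integrable (fun x => v x * lap φ x) ∧ Integrable fun x => q x * v x * φ x := by
    intro q v hw hqm hq hc φ hφ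
    have hφΩ : IsTestFunction Ω φ :=
      ⟨hφ.smooth, hφ.compactSupport, hφ.support_subset.trans hGΩ⟩
    have hφ0 : ∀ x ∉ Ω, φ x = 0 := fun x hx =>
      image_eq_zero_of_notMem_tsupport fun h => hx (hφΩ.support_subset h)
    have hl0 : ∀ x ∉ Ω, lap φ x = 0 := fun x hx =>
      image_eq_zero_of_notMem_tsupport fun h => hx (hφΩ.support_subset (tsupport_lap_subset φ h))
    have hlc : Continuous (lap φ) := (contDiff_lap hφ.smooth).continuous
    refine ⟨?_, ?_, ?_⟩
    · have e1 : ∫ x in Ω, v x * lap φ x = ∫ x, v x * lap φ x :=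
        setIntegral_eq_integral_of_forall_compl_eq_zero fun x hx => by simp [hl0 x hx]
      have e2 : ∫ x in Ω, q x * v x * φ x = ∫ x, q x * v x * φ x :=
        setIntegral_eq_integral_of_forall_compl_eq_zero fun x hx => by simp [hφ0 x hx]
      rw [← e1, ← e2, hw φ hφΩ]
    · refine (integrableOn_iff_integrable_of_support_subset (s := Ω) fun x hx => ?_).1 ?_
      · by_contra h
        exact hx (by simp [hl0 x h])
      · exact ((hc.mul hlc.continuousOn).integrableOn_compact hb.isCompact_closure).mono_set
          subset_closure
    · refine (integrableOn_iff_integrable_of_support_subset (s := Ω) fun x hx => ?_).1 ?_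
      · by_contra h
        exact hx (by simp [hφ0 x h])
      · simpa only [mul_assoc] using integrableOn_bdd_mul hb hqm (hKa hq)
          (c := fun x => v x * φ x)
          (hc.mul hφ.smooth.continuous.continuousOn)
  have hcore : 0 ≤ ∫ x in G, ((v₁ x + v₂ x) * F (v₁ x - v₂ x) * (q₁ x * v₁ x - q₂ x * v₂ x) -
      Φ (v₁ x - v₂ x) * (q₁ x * v₁ x + q₂ x * v₂ x)) := by
    refine setIntegral_truncation_nonneg (K := K) (t₀ := 2 * η) (t := 3 * η) (A := A)
      (s := fun x => v₁ x + v₂ x) (w := fun x => v₁ x - v₂ x)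
      (P := fun x => q₁ x * v₁ x - q₂ x * v₂ x) (Q := fun x => q₁ x * v₁ x + q₂ x * v₂ x)
      hG hA hAG ((hco₁.add hco₂).mono hGΩ) ((hco₁.sub hco₂).mono hGΩ)
      (fun x hx => (add_pos hx.2.1 hx.2.2).le) ((hqG₁.mul hvm₁).sub (hqG₂.mul hvm₂))
      ((hqG₁.mul hvm₁).add (hqG₂.mul hvm₂)) ?_ ?_ hK0.le ?_ ?_ (by positivity) (by linarith)
      ?_ hF hΦ hΦF hmono hF0 hΦ0
    · filter_upwards [hae] with x ⟨h1, h2, _, h4, h5⟩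
      have := inv_pos.2 hK0
      have a1 : 0 ≤ q₁ x * v₁ x := mul_nonneg (by linarith [h1.1]) h4.le
      have a2 : 0 ≤ q₂ x * v₂ x := mul_nonneg (by linarith [h2.1]) h5.le
      have b1 := mul_le_mul_of_nonneg_right h1.2 h4.le
      have b2 := mul_le_mul_of_nonneg_right h2.2 h5.le
      rw [abs_le]
      constructor <;> linarith
    · filter_upwards [hae] with x ⟨h1, h2, _, h4, h5⟩
      have := inv_pos.2 hK0
      have a1 : 0 ≤ q₁ x * v₁ x := mul_nonneg (by linarith [h1.1]) h4.le
      have a2 : 0 ≤ q₂ x * v₂ x := mul_nonneg (by linarith [h2.1]) h5.le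
      have b1 := mul_le_mul_of_nonneg_right h1.2 h4.le
      have b2 := mul_le_mul_of_nonneg_right h2.2 h5.le
      rw [abs_le]
      constructor <;> linarith
    · intro φ hφ
      obtain ⟨e1, i1, j1⟩ := htest hw₁ hqm₁ hq₁ hc₁ φ hφ
      obtain ⟨e2, i2, j2⟩ := htest hw₂ hqm₂ hq₂ hc₂ φ hφ
      simp only [add_mul]
      rw [integral_add i1 i2, integral_add j1 j2, e1, e2]
      ring
    · intro φ hφ
      obtain ⟨e1, i1, j1⟩ := htest hw₁ hqm₁ hq₁ hc₁ φ hφ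
      obtain ⟨e2, i2, j2⟩ := htest hw₂ hqm₂ hq₂ hc₂ φ hφ
      simp only [sub_mul]
      rw [integral_sub i1 i2, integral_sub j1 j2, e1, e2]
      ring
    · exact fun x hx h => ⟨subset_closure hx.1, hx.2.1.le, hx.2.2.le, h⟩
  have hΩint : ∀ {c : EuclideanSpace ℝ (Fin d) → ℝ}, ContinuousOn c (closure Ω) →
      IntegrableOn c Ω := fun hc =>
    (hc.integrableOn_compact hb.isCompact_closure).mono_set subset_closure
  have hsint : IntegrableOn (fun x => |v₁ x| + |v₂ x|) Ω := hΩint (hc₁.abs.add hc₂.abs)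
  have hFc : ContinuousOn (fun x => F (v₁ x - v₂ x)) (closure Ω) :=
    hF.continuous.comp_continuousOn (hc₁.sub hc₂)
  have hΦc : ContinuousOn (fun x => Φ (v₁ x - v₂ x)) (closure Ω) :=
    hΦ.continuous.comp_continuousOn (hc₁.sub hc₂)
  have hcint : IntegrableOn (fun x => (v₁ x + v₂ x) * F (v₁ x - v₂ x) *
      (q₁ x * v₁ x - q₂ x * v₂ x) - Φ (v₁ x - v₂ x) * (q₁ x * v₁ x + q₂ x * v₂ x)) G := by
    have i1 := integrableOn_bdd_mul hb hqm₁ (hKa hq₁)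
      ((((hc₁.add hc₂).mul hFc).sub hΦc).mul hc₁)
    have i2 := integrableOn_bdd_mul hb hqm₂ (hKa hq₂)
      ((((hc₁.add hc₂).mul hFc).add hΦc).mul hc₂)
    -- Regrouped by coefficient: q₁(sF - Φ)v₁ - q₂(sF + Φ)v₂.
    refine Integrable.congr ((i1.sub i2).mono_set hGΩ) (Eventually.of_forall fun x => ?_)
    simp only [Pi.sub_apply, Pi.add_apply, Pi.mul_apply]
    ring
  have hbound : ∫ x in G, (|v₁ x| + |v₂ x|) * (|v₁ x| - |v₂ x|) ^ 2 ≤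
      ∫ x in G, ((2 * K + 18 * K ^ 3) * ε * (|v₁ x| + |v₂ x|) -
        K * ((v₁ x + v₂ x) * F (v₁ x - v₂ x) * (q₁ x * v₁ x - q₂ x * v₂ x) -
          Φ (v₁ x - v₂ x) * (q₁ x * v₁ x + q₂ x * v₂ x))) := by
    refine integral_mono_ae
      ((hΩint ((hc₁.abs.add hc₂.abs).mul ((hc₁.abs.sub hc₂.abs).pow 2))).mono_set hGΩ)
      (((hsint.mono_set hGΩ).const_mul _).sub (hcint.const_mul K)) ?_
    filter_upwards [hae] with x ⟨h1, h2, h3, h4, h5⟩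
    simp only [abs_of_pos h4, abs_of_pos h5]
    set s := v₁ x + v₂ x with hs
    set w := v₁ x - v₂ x with hw
    set Q := q₁ x * v₁ x + q₂ x * v₂ x with hQ
    set P := q₁ x * v₁ x - q₂ x * v₂ x with hP
    set f := q₁ x * v₁ x ^ 2 - q₂ x * v₂ x ^ 2 with hfd
    have hs0 : 0 < s := add_pos h4 h5
    -- This is sP + wQ = 2f multiplied by F(w).
    have hid : s * F w * P = 2 * (f * F w) - Q * (w * F w) := by
      rw [hs, hw, hQ, hP, hfd]; ring
    have hsQ : s ≤ K * Q := by
      have a1 := mul_le_mul_of_nonneg_right h1.1 h4.le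
      have a2 := mul_le_mul_of_nonneg_right h2.1 h5.le
      rw [← inv_mul_le_iff₀ hK0, hs, hQ]
      linarith
    have hQs : Q ≤ K * s := by
      have b1 := mul_le_mul_of_nonneg_right h1.2 h4.le
      have b2 := mul_le_mul_of_nonneg_right h2.2 h5.le
      rw [hs, hQ]
      linarith
    have hQ0 : 0 ≤ Q := by
      by_contra! hneg
      nlinarith
    have hfF : f * F w ≤ ε * s := by
      have hws : |w| ≤ s := abs_le.2 ⟨by linarith, by linarith⟩
      calc f * F w ≤ |f| * |F w| := by rw [← abs_mul]; exact le_abs_self _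
        _ ≤ ε * s := mul_le_mul h3 ((hFle w).trans hws) (abs_nonneg _) hε.le
    -- The truncation loss 2t² with t = 3η and η² = Kε.
    have hww : w ^ 2 ≤ w * F w + 18 * (K * ε) := by
      have := hFsq w
      rw [mul_pow, hη2] at this
      linarith
    calc s * w ^ 2 ≤ K * Q * w ^ 2 := by gcongr
      _ ≤ K * Q * (w * F w + 18 * (K * ε)) := by gcongr
      _ = K * (2 * (f * F w) - s * F w * P) + 18 * K ^ 2 * ε * Q := by rw [hid]; ring
      _ ≤ K * (2 * (ε * s) - s * F w * P) + 18 * K ^ 2 * ε * (K * s) := by gcongr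
      _ ≤ (2 * K + 18 * K ^ 3) * ε * s - K * (s * F w * P - Φ w * Q) := by
        have : 0 ≤ K * (Φ w * Q) := mul_nonneg hK0.le (mul_nonneg (hΦnn w) hQ0)
        linarith
  rw [integral_sub ((hsint.mono_set hGΩ).const_mul _) (hcint.const_mul K), integral_const_mul,
    integral_const_mul] at hbound
  have hsG : ∫ x in G, (|v₁ x| + |v₂ x|) ≤ B :=
    (setIntegral_mono_set hsint (Eventually.of_forall fun x => by positivity)
      (Eventually.of_forall hGΩ)).trans hB
  have := mul_le_mul_of_nonneg_left hsG (by positivity : 0 ≤ (2 * K + 18 * K ^ 3) * ε)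
  have := mul_nonneg hK0.le hcore
  linarith

/-! ### Assembling the sign regions -/

/-- From |u| ≤ (1 + u²)/2. Volume and energy thus control the weight |u₁| + |u₂|. -/
lemma APriori.setIntegral_abs_le {Ω : Set (EuclideanSpace ℝ (Fin d))} (hb : Bornology.IsBounded Ω)
    {K E H V : ℝ} (hV : 0 ≤ V) (hvol : volume Ω = ENNReal.ofReal V)
    {q u : EuclideanSpace ℝ (Fin d) → ℝ}
    {g : EuclideanSpace ℝ (Fin d) → EuclideanSpace ℝ (Fin d)} (h : APriori Ω K E H q u g) :
    ∫ x in Ω, |u x| ≤ (V + E ^ 2) / 2 := by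
  have hint : ∀ {c : EuclideanSpace ℝ (Fin d) → ℝ}, ContinuousOn c (closure Ω) →
      IntegrableOn c Ω := fun hc =>
    (hc.integrableOn_compact hb.isCompact_closure).mono_set subset_closure
  have hg : IntegrableOn (fun x => ‖g x‖ ^ 2) Ω := h.solution.isW12.memLp_gradient.integrable_norm_pow
    (by simp)
  have hu : IntegrableOn (fun x => u x ^ 2) Ω := hint (h.continuousOn.pow 2)
  have hone : IntegrableOn (fun _ => (1 : ℝ)) Ω := hint continuousOn_const
  have hE : ∫ x in Ω, u x ^ 2 ≤ E ^ 2 :=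
    (integral_mono hu (hu.add hg) fun x => by simp).trans h.energy
  have h1 : ∫ _ in Ω, (1 : ℝ) = V := by
    simp [Measure.real, hvol, hV]
  have hle : ∫ x in Ω, |u x| ≤ ∫ x in Ω, (1 + u x ^ 2) / 2 := by
    refine integral_mono (hint h.continuousOn.abs) ((hone.add hu).div_const 2) fun x => ?_
    simp only
    nlinarith [sq_nonneg (|u x| - 1), sq_abs (u x)]
  rw [integral_div, integral_add hone hu, h1] at hle
  linarith

lemma abs_mul_of_sign {σ a : ℝ} (hσ : σ = 1 ∨ σ = -1) : |σ * a| = |a| := by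
  rcases hσ with rfl | rfl <;> simp

end HybridInverse

open HybridInverse in
theorem theorem2p1 (K E V : ℝ) (hK : 1 ≤ K) (hE : 0 < E) (hV : 0 < V) :
    ∃ C : ℝ, 0 < C ∧
      ∀ (n : ℕ) (Ω : Set (EuclideanSpace ℝ (Fin (n + 1)))) (ρ M H ε : ℝ)
        (q₁ q₂ u₁ u₂ : EuclideanSpace ℝ (Fin (n + 1)) → ℝ)
        (g₁ g₂ : EuclideanSpace ℝ (Fin (n + 1)) → EuclideanSpace ℝ (Fin (n + 1))),
        IsOpen Ω → IsConnected Ω → Bornology.IsBounded Ω →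
        volume Ω = ENNReal.ofReal V →
        0 < ρ → 0 < M → HybridInverse.IsLipschitzClass Ω ρ M →
        0 < H →
        HybridInverse.APriori Ω K E H q₁ u₁ g₁ →
        HybridInverse.APriori Ω K E H q₂ u₂ g₂ →
        0 < ε →
        eLpNorm (fun x => q₁ x * u₁ x ^ 2 - q₂ x * u₂ x ^ 2) ∞ (volume.restrict Ω)
          ≤ ENNReal.ofReal ε →
        eLpNorm (fun x => |u₁ x| - |u₂ x|) ∞ ((Measure.hausdorffMeasure (n : ℝ)).restrict (frontier Ω))
          ≤ ENNReal.ofReal (Real.sqrt (K * ε)) →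
        IntegrableOn (fun x => (|u₁ x| + |u₂ x|) * (|u₁ x| - |u₂ x|) ^ 2) Ω ∧
          ∫ x in Ω, (|u₁ x| + |u₂ x|) * (|u₁ x| - |u₂ x|) ^ 2 ≤ C * ε := by
  -- Four sign regions, plus `K` for the nodal sets; V + E² bounds ∫ (|u₁| + |u₂|).
  refine ⟨(4 * (2 * K + 18 * K ^ 3) + K) * (V + E ^ 2), by positivity, ?_⟩
  intro n Ω ρ M H ε q₁ q₂ u₁ u₂ g₁ g₂ hΩ _ hb hvol hρ hM hL _ h₁ h₂ hε hf hfr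
  have hK0 : 0 < K := by linarith
  have hc₁ := h₁.continuousOn
  have hc₂ := h₂.continuousOn
  have hfae := ae_abs_le_of_eLpNorm_top_le hε.le hf
  have hfr' : ∀ x ∈ frontier Ω, |(|u₁ x| - |u₂ x|)| ≤ √(K * ε) :=
    abs_le_on_frontier hΩ hρ hM hL (Real.sqrt_nonneg _) (hc₁.abs.sub hc₂.abs) hfr
  have hint : ∀ {c : EuclideanSpace ℝ (Fin (n + 1)) → ℝ}, ContinuousOn c (closure Ω) →
      IntegrableOn c Ω := fun hc =>
    (hc.integrableOn_compact hb.isCompact_closure).mono_set subset_closure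
  set h : EuclideanSpace ℝ (Fin (n + 1)) → ℝ :=
    fun x => (|u₁ x| + |u₂ x|) * (|u₁ x| - |u₂ x|) ^ 2 with hh
  have hhint : IntegrableOn h Ω := hint ((hc₁.abs.add hc₂.abs).mul ((hc₁.abs.sub hc₂.abs).pow 2))
  have hsint : IntegrableOn (fun x => |u₁ x| + |u₂ x|) Ω := hint (hc₁.abs.add hc₂.abs)
  have hB : ∫ x in Ω, (|u₁ x| + |u₂ x|) ≤ V + E ^ 2 := by
    rw [integral_add (hint hc₁.abs) (hint hc₂.abs)]
    linarith [h₁.setIntegral_abs_le hb hV.le hvol, h₂.setIntegral_abs_le hb hV.le hvol]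
  refine ⟨hhint, ?_⟩
  have hh0 : ∀ x, 0 ≤ h x := fun x => by positivity
  set S : ℝ → ℝ → Set (EuclideanSpace ℝ (Fin (n + 1))) :=
    fun σ τ => Ω ∩ {x | 0 < σ * u₁ x ∧ 0 < τ * u₂ x} with hS
  have hco₁ := hc₁.mono (subset_closure (s := Ω))
  have hco₂ := hc₂.mono (subset_closure (s := Ω))
  have hSm : ∀ σ τ, MeasurableSet (S σ τ) := fun σ τ =>
    (((continuousOn_const.mul hco₁).prodMk (continuousOn_const.mul hco₂)).isOpen_inter_preimage hΩ
      ((isOpen_Ioi (a := (0 : ℝ))).prod (isOpen_Ioi (a := (0 : ℝ))))).measurableSet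
  -- The equation is linear and the data involve only |uᵢ|, so the positive case applies to σu₁ and
  -- τu₂.
  have hSle : ∀ σ τ, (σ = 1 ∨ σ = -1) → (τ = 1 ∨ τ = -1) →
      ∫ x in Ω, (S σ τ).indicator h x ≤ (2 * K + 18 * K ^ 3) * ε * (V + E ^ 2) := by
    intro σ τ hσ hτ
    have hσ2 : σ ^ 2 = 1 := by rcases hσ with rfl | rfl <;> norm_num
    have hτ2 : τ ^ 2 = 1 := by rcases hτ with rfl | rfl <;> norm_num
    have hsol : ∀ {q u : EuclideanSpace ℝ (Fin (n + 1)) → ℝ}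
        {g : EuclideanSpace ℝ (Fin (n + 1)) → EuclideanSpace ℝ (Fin (n + 1))} (c : ℝ),
        IsWeakSolution Ω q u g → ∀ φ, IsTestFunction Ω φ →
        ∫ x in Ω, c * u x * lap φ x = -∫ x in Ω, q x * (c * u x) * φ x := by
      intro q u g c hw φ hφ
      have e1 : ∀ x, c * u x * lap φ x = c * (u x * lap φ x) := fun x => by ring
      have e2 : ∀ x, q x * (c * u x) * φ x = c * (q x * u x * φ x) := fun x => by ring
      simp only [e1, e2, integral_const_mul, hw.setIntegral_mul_lap hφ, mul_neg]
    have key := setIntegral_pos_le hΩ hb hK hε h₁.memLp_q.1 h₂.memLp_q.1 h₁.bounds_q h₂.bounds_q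
      (v₁ := fun x => σ * u₁ x) (v₂ := fun x => τ * u₂ x) (B := V + E ^ 2)
      (continuousOn_const.mul hc₁) (continuousOn_const.mul hc₂) (hsol σ h₁.solution)
      (hsol τ h₂.solution) (by simpa only [mul_pow, hσ2, hτ2, one_mul] using hfae)
      (by simpa only [abs_mul_of_sign hσ, abs_mul_of_sign hτ] using hfr')
      (by simpa only [abs_mul_of_sign hσ, abs_mul_of_sign hτ] using hB)
    simp only [abs_mul_of_sign hσ, abs_mul_of_sign hτ] at key
    rw [setIntegral_indicator (hSm σ τ), inter_eq_self_of_subset_right inter_subset_left]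
    exact key
  have hz₁ := abs_le_sqrt_of_eq_zero hΩ hK h₁.bounds_q h₂.bounds_q hco₁ hco₂ hfae
  have hz₂ := abs_le_sqrt_of_eq_zero hΩ hK h₂.bounds_q h₁.bounds_q hco₂ hco₁
    (by simpa only [abs_sub_comm] using hfae)
  -- Where a solution vanishes, the other is at most √(Kε) in absolute value, which the last term
  -- covers.
  have hpt : ∀ x ∈ Ω, h x ≤ (S 1 1).indicator h x + (S 1 (-1)).indicator h x +
      (S (-1) 1).indicator h x + (S (-1) (-1)).indicator h x +
        K * ε * (|u₁ x| + |u₂ x|) := by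
    intro x hx
    have n1 := indicator_nonneg (s := S 1 1) (fun y _ => hh0 y) x
    have n2 := indicator_nonneg (s := S 1 (-1)) (fun y _ => hh0 y) x
    have n3 := indicator_nonneg (s := S (-1) 1) (fun y _ => hh0 y) x
    have n4 := indicator_nonneg (s := S (-1) (-1)) (fun y _ => hh0 y) x
    have n5 : 0 ≤ K * ε * (|u₁ x| + |u₂ x|) := by positivity
    have hsmall : |(|u₁ x| - |u₂ x|)| ≤ √(K * ε) → h x ≤ K * ε * (|u₁ x| + |u₂ x|) := by
      intro hle
      have : (|u₁ x| - |u₂ x|) ^ 2 ≤ K * ε := by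
        have := pow_le_pow_left₀ (abs_nonneg _) hle 2
        rwa [sq_abs, Real.sq_sqrt (by positivity)] at this
      calc h x ≤ (|u₁ x| + |u₂ x|) * (K * ε) := mul_le_mul_of_nonneg_left this (by positivity)
        _ = K * ε * (|u₁ x| + |u₂ x|) := by ring
    rcases lt_trichotomy (u₁ x) 0 with a | a | a
    · rcases lt_trichotomy (u₂ x) 0 with b | b | b
      · have : (S (-1) (-1)).indicator h x = h x :=
          indicator_of_mem (s := S (-1) (-1)) ⟨hx, by simpa using ⟨a, b⟩⟩ h
        linarith
      · have := hsmall (by simpa [b] using hz₂ x hx b)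
        linarith
      · have : (S (-1) 1).indicator h x = h x :=
          indicator_of_mem (s := S (-1) 1) ⟨hx, by simpa using ⟨a, b⟩⟩ h
        linarith
    · have := hsmall (by simpa [a] using hz₁ x hx a)
      linarith
    · rcases lt_trichotomy (u₂ x) 0 with b | b | b
      · have : (S 1 (-1)).indicator h x = h x :=
          indicator_of_mem (s := S 1 (-1)) ⟨hx, by simpa using ⟨a, b⟩⟩ h
        linarith
      · have := hsmall (by simpa [b] using hz₂ x hx b)
        linarith
      · have : (S 1 1).indicator h x = h x :=
          indicator_of_mem (s := S 1 1) ⟨hx, by simpa using ⟨a, b⟩⟩ h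
        linarith
  have hi : ∀ σ τ, IntegrableOn ((S σ τ).indicator h) Ω := fun σ τ => hhint.indicator (hSm σ τ)
  have hi2 : IntegrableOn (fun x => (S 1 1).indicator h x + (S 1 (-1)).indicator h x) Ω :=
    (hi 1 1).add (hi 1 (-1))
  have hi3 : IntegrableOn (fun x => (S 1 1).indicator h x + (S 1 (-1)).indicator h x +
      (S (-1) 1).indicator h x) Ω := hi2.add (hi (-1) 1)
  have hi4 : IntegrableOn (fun x => (S 1 1).indicator h x + (S 1 (-1)).indicator h x +
      (S (-1) 1).indicator h x + (S (-1) (-1)).indicator h x) Ω := hi3.add (hi (-1) (-1))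
  have hi5 : IntegrableOn (fun x => K * ε * (|u₁ x| + |u₂ x|)) Ω := hsint.const_mul _
  have htot := setIntegral_mono_on hhint (hi4.add hi5) hΩ.measurableSet hpt
  simp only [Pi.add_apply] at htot
  rw [integral_add hi4 hi5, integral_add hi3 (hi _ _), integral_add hi2 (hi _ _),
    integral_add (hi _ _) (hi _ _), integral_const_mul] at htot
  have k1 := hSle 1 1 (.inl rfl) (.inl rfl)
  have k2 := hSle 1 (-1) (.inl rfl) (.inr rfl)
  have k3 := hSle (-1) 1 (.inr rfl) (.inl rfl)
  have k4 := hSle (-1) (-1) (.inr rfl) (.inr rfl)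
  have k5 := mul_le_mul_of_nonneg_left hB (by positivity : 0 ≤ K * ε)
  linarith
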